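/- Let $q$ be a prime, let $\log$ be the logarithm to base $2$ and $H$ the Shannon entropy in bits. Let $D(q):=H(U_1+U_2)-\log q$, where $U_1,U_2$ are independent and uniform on $\{0,\dots,q-1\}\subset\mathbb Z$ and $U_1+U_2$ is their integer sum. Write $a_n\doteq 2^{nb}$ if there are $\epsilon_n\searrow 0$ with $2^{n(b-\epsilon_n)}\le a_n\le 2^{n(b+\epsilon_n)}$ for all large $n$. For every $n$ let $C_1^{(n)},C_2^{(n)}\subseteq\mathbb F_q^n$ be linear codes (subspaces), such that the rates $R_j:=\lim_{n\to\infty}\frac1n\log|C_j^{(n)}|$, $j=1,2$, exist, and let $d^{(n)}\in\mathbb F_q^n$ be a fixed vector (for instance $d^{(n)}=0$). View the coset $C_1^{(n)}\oplus d^{(n)}$ (addition modulo $q$) and the code $C_2^{(n)}$ as sets of integer vectors with entries in $\{0,\dots,q-1\}$. Let $T_1^n$ and $T_2^n$ be independent random vectors, uniformly distributed on $C_1^{(n)}\oplus d^{(n)}$ and on $C_2^{(n)}$ respectively, and let $T_1^n+T_2^n$ be their sum in $\mathbb Z^n$. Suppose that these codes have a normal typical sumset, that is, there are sets $\mathcal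 K^{(n)}\subseteq (C_1^{(n)}\oplus d^{(n)})+C_2^{(n)}$ (sumset in $\mathbb Z^n$) such that $\Pr[T_1^n+T_2^n\in\mathcal K^{(n)}]\to1$, $$|\mathcal K^{(n)}|\doteq\min\{2^{n(R_1+R_2)},\,2^{n(\max\{R_1,R_2\}+D(q))}\},$$ and, uniformly for all $w\in\mathcal K^{(n)}$, $$\Pr[T_1^n+T_2^n=w]\doteq\max\{2^{-n(R_1+R_2)},\,2^{-n(\max\{R_1,R_2\}+D(q))}\}.$$ Then $$\lim_{n\to\infty}\frac{H(T_1^n+T_2^n)}{n}=\min\{R_1+R_2,\ \max\{R_1,R_2\}+D(q)\},$$ and the same number is the limit $$\lim_{n\to\infty}\min\Big\{\frac{H(T_1^n)+H(T_2^n)}{n},\ \frac{\max\{H(T_1^n),H(T_2^n)\}}{n}+D(q)\Big\}.$$ -/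

import Mathlib

open MeasureTheory ProbabilityTheory Filter Topology
open scoped Pointwise

/-- A word over `𝔽_q = ZMod q`, read as an integer vector with entries in `{0, …, q - 1}`. -/
def intVec {q n : ℕ} (t : Fin n → ZMod q) : Fin n → ℤ :=
  fun i => ((t i).val : ℤ)

/-- The coset `C ⊕ d` (addition modulo `q`) of a linear code `C ⊆ 𝔽_q ^ n`, viewed as a set of
integer vectors with entries in `{0, …, q - 1}`. For `d = 0` this is the code itself. -/
def codebook {q n : ℕ} (C : Submodule (ZMod q) (Fin n → ZMod q)) (d : Fin n → ZMod q) :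
    Set (Fin n → ℤ) :=
  (fun t => intVec (t + d)) '' (C : Set (Fin n → ZMod q))

/-- The Shannon entropy, in bits, of a probability measure on a discrete space:
`- ∑ x, μ(x) log₂ μ(x)`, with `0 log 0 = 0`. It is only used for finitely supported measures. -/
noncomputable def entropyBits {S : Type*} [MeasurableSpace S] (μ : Measure S) : ℝ :=
  ∑' x, -(μ.real {x} * Real.logb 2 (μ.real {x}))

/-- The Shannon entropy `H(X)`, in bits, of a discrete random variable `X`. -/
noncomputable def rvEntropy {Ω S : Type*} [MeasurableSpace Ω] [MeasurableSpace S]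
    (P : Measure Ω) (X : Ω → S) : ℝ :=
  entropyBits (P.map X)

/-- The law of `T₁ + T₂` (addition in the ambient monoid) for independent `T₁`, `T₂` which are
uniformly distributed on `A` and on `B`. -/
noncomputable def sumLaw {M : Type*} [AddMonoid M] [MeasurableSpace M] (A B : Set M) : Measure M :=
  ((uniformOn A).prod (uniformOn B)).map (fun p => p.1 + p.2)

/-- `D(q) = H(U₁ + U₂) - log₂ q` with `U₁`, `U₂` independent and uniform on `{0, …, q - 1}`, the
sum being taken in `ℤ`. -/
noncomputable def sumsetD (q : ℕ) : ℝ :=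
  entropyBits (sumLaw (Set.Ico (0 : ℤ) q) (Set.Ico (0 : ℤ) q)) - Real.logb 2 q

/-- `a n w ≐ 2 ^ (n b)`, uniformly over `w ∈ s n`: there is `ε n ↘ 0` such that, for large `n`,
`2 ^ (n (b - ε n)) ≤ a n w ≤ 2 ^ (n (b + ε n))` for all `w ∈ s n`. -/
def DotEqOn {ι : ℕ → Type*} (s : ∀ n, Set (ι n)) (a : ∀ n, ι n → ℝ) (b : ℝ) : Prop :=
  ∃ ε : ℕ → ℝ, Antitone ε ∧ Tendsto ε atTop (𝓝 0) ∧
    ∀ᶠ n : ℕ in atTop, ∀ w ∈ s n,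
      (2 : ℝ) ^ ((n : ℝ) * (b - ε n)) ≤ a n w ∧ a n w ≤ (2 : ℝ) ^ ((n : ℝ) * (b + ε n))

/-- `a n ≐ 2 ^ (n b)`: there is `ε n ↘ 0` such that, for large `n`,
`2 ^ (n (b - ε n)) ≤ a n ≤ 2 ^ (n (b + ε n))`. -/
def DotEq (a : ℕ → ℝ) (b : ℝ) : Prop :=
  ∃ ε : ℕ → ℝ, Antitone ε ∧ Tendsto ε atTop (𝓝 0) ∧
    ∀ᶠ n : ℕ in atTop,
      (2 : ℝ) ^ ((n : ℝ) * (b - ε n)) ≤ a n ∧ a n ≤ (2 : ℝ) ^ ((n : ℝ) * (b + ε n))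

/-- `K n ⊆ A n + B n` is a sequence of typical sumsets of `A n`, `B n`: the sum of two independent
uniformly distributed elements of `A n` and `B n` is in `K n` asymptotically almost surely. -/
structure IsTypicalSumset (A B K : ∀ n : ℕ, Set (Fin n → ℤ)) : Prop where
  subset_add : ∀ n, K n ⊆ A n + B n
  tendsto_prob : Tendsto (fun n => (sumLaw (A n) (B n)).real (K n)) atTop (𝓝 1)

/-- `K n` is a sequence of normal typical sumsets of the codebooks `A n`, `B n` over `𝔽_q` with
asymptotic rates `R₁`, `R₂`: typical sumsets with
`|K n| ≐ min {2 ^ (n (R₁ + R₂)), 2 ^ (n (max {R₁, R₂} + D(q)))}` such that the law of the sum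
satisfies `P(w) ≐ max {2 ^ (- n (R₁ + R₂)), 2 ^ (- n (max {R₁, R₂} + D(q)))}` for all `w ∈ K n`. -/
structure IsNormalTypicalSumset (q : ℕ) (R₁ R₂ : ℝ) (A B K : ∀ n : ℕ, Set (Fin n → ℤ)) : Prop
    extends IsTypicalSumset A B K where
  card_doteq : DotEq (fun n => ((K n).ncard : ℝ)) (min (R₁ + R₂) (max R₁ R₂ + sumsetD q))
  prob_doteq : DotEqOn K (fun n w => (sumLaw (A n) (B n)).real {w})
    (-min (R₁ + R₂) (max R₁ R₂ + sumsetD q))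

/-!
On the typical sumset the self-information of `T₁ + T₂` is `n (I + o(1))` bits, where `I` is the
claimed limit. The typical sumset carries mass `1 - o(1)`, so it contributes `n (I + o(1))` bits to
the entropy. The remaining mass `o(1)` lives on at most `|C₁| |C₂| = 2 ^ O(n)` points, and a mass
`m` spread over `N` points contributes at most `m log₂ N + O(1)` bits, here `o(n)`.
The second limit is immediate, since `H(Tⱼ) = log₂ |Cⱼ|`.
-/

section Entropy

lemma neg_mul_logb_nonneg {p : ℝ} (hp₀ : 0 ≤ p) (hp₁ : p ≤ 1) : 0 ≤ -(p * Real.logb 2 p) :=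
  neg_nonneg.2 (mul_nonpos_of_nonneg_of_nonpos hp₀ (Real.logb_nonpos one_lt_two hp₀ hp₁))

lemma neg_mul_logb_le {p N : ℝ} (hp : 0 ≤ p) (hN : 0 < N) :
    -(p * Real.logb 2 p) ≤ p * Real.logb 2 N + N⁻¹ * (Real.log 2)⁻¹ := by
  rcases hp.eq_or_lt with rfl | hp
  · simp only [zero_mul, neg_zero, zero_add]
    positivity
  have hlog : -(p * Real.log p) ≤ p * Real.log N + N⁻¹ := by
    have h := mul_le_mul_of_nonneg_left
      (Real.one_sub_inv_le_log_of_pos (mul_pos hp hN)) hp.le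
    rw [Real.log_mul hp.ne' hN.ne', mul_sub, mul_inv, mul_inv_cancel_left₀ hp.ne'] at h
    linarith
  calc -(p * Real.logb 2 p) = -(p * Real.log p) * (Real.log 2)⁻¹ := by
        rw [Real.logb, div_eq_mul_inv]; ring
    _ ≤ (p * Real.log N + N⁻¹) * (Real.log 2)⁻¹ := by gcongr
    _ = p * Real.logb 2 N + N⁻¹ * (Real.log 2)⁻¹ := by
        rw [Real.logb, div_eq_mul_inv]; ring

lemma sum_neg_mul_logb_le {ι : Type*} {u : Finset ι} {f : ι → ℝ} {N : ℝ}
    (hf : ∀ i ∈ u, 0 ≤ f i) (hN : (u.card : ℝ) ≤ N) :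
    ∑ i ∈ u, -(f i * Real.logb 2 (f i)) ≤
      (∑ i ∈ u, f i) * Real.logb 2 N + (Real.log 2)⁻¹ := by
  have hlog2 : 0 < Real.log 2 := Real.log_pos one_lt_two
  rcases u.eq_empty_or_nonempty with rfl | hu
  · simpa using hlog2.le
  have hN₀ : 0 < N := (Nat.cast_pos.2 hu.card_pos).trans_le hN
  have hcard : (u.card : ℝ) * N⁻¹ ≤ 1 := by
    rw [← div_eq_mul_inv]
    exact (div_le_one hN₀).2 hN
  calc ∑ i ∈ u, -(f i * Real.logb 2 (f i))
      ≤ ∑ i ∈ u, (f i * Real.logb 2 N + N⁻¹ * (Real.log 2)⁻¹) :=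
        Finset.sum_le_sum fun i hi => neg_mul_logb_le (hf i hi) hN₀
    _ = (∑ i ∈ u, f i) * Real.logb 2 N + u.card * N⁻¹ * (Real.log 2)⁻¹ := by
        rw [Finset.sum_add_distrib, ← Finset.sum_mul, Finset.sum_const, nsmul_eq_mul, mul_assoc]
    _ ≤ (∑ i ∈ u, f i) * Real.logb 2 N + (Real.log 2)⁻¹ := by
        gcongr
        exact mul_le_of_le_one_left (inv_nonneg.2 hlog2.le) hcard

variable {S : Type*} [MeasurableSpace S]

lemma entropyBits_eq_sum {μ : Measure S} {s : Finset S} (hs : ∀ᵐ x ∂μ, x ∈ s) :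
    entropyBits μ = ∑ x ∈ s, -(μ.real {x} * Real.logb 2 (μ.real {x})) := by
  refine tsum_eq_sum fun x hx => ?_
  have hμx : μ {x} = 0 := measure_mono_null (by simpa using hx) (mem_ae_iff.1 hs)
  simp [measureReal_def, hμx]

lemma finite_of_hasLaw_uniformOn {Ω : Type*} [MeasurableSpace Ω] {P : Measure Ω}
    [IsProbabilityMeasure P] {X : Ω → S} {A : Set S} (hX : HasLaw X (uniformOn A) P) :
    A.Finite := by
  have := hX.isProbabilityMeasure_iff.1 inferInstance
  exact finite_of_uniformOn_ne_zero (t := Set.univ) (by simp)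

variable [MeasurableSingletonClass S]

lemma sum_filter_measureReal_singleton {μ : Measure S} [IsFiniteMeasure μ] {s : Finset S}
    (hs : ∀ᵐ x ∂μ, x ∈ s) (t : Set S) [DecidablePred (· ∈ t)] :
    ∑ x ∈ s with x ∈ t, μ.real {x} = μ.real t := by
  rw [sum_measureReal_singleton, Finset.coe_filter]
  refine measureReal_congr ?_
  filter_upwards [hs] with x hx
  exact propext (and_iff_right hx)

lemma mul_le_entropyBits {μ : Measure S} [IsProbabilityMeasure μ] {s t : Set S} {a : ℝ}
    (hs : s.Finite) (hμs : ∀ᵐ x ∂μ, x ∈ s) (ha : ∀ x ∈ t, a ≤ -Real.logb 2 (μ.real {x})) :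
    μ.real t * a ≤ entropyBits μ := by
  classical
  lift s to Finset S using hs
  calc μ.real t * a = ∑ x ∈ s with x ∈ t, μ.real {x} * a := by
        rw [← Finset.sum_mul, sum_filter_measureReal_singleton hμs]
    _ ≤ ∑ x ∈ s with x ∈ t, -(μ.real {x} * Real.logb 2 (μ.real {x})) := by
        refine Finset.sum_le_sum fun x hx => ?_
        rw [← mul_neg]
        exact mul_le_mul_of_nonneg_left (ha x (Finset.mem_filter.1 hx).2) measureReal_nonneg
    _ ≤ ∑ x ∈ s, -(μ.real {x} * Real.logb 2 (μ.real {x})) :=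
        Finset.sum_le_sum_of_subset_of_nonneg (Finset.filter_subset _ _) fun _ _ _ =>
          neg_mul_logb_nonneg measureReal_nonneg measureReal_le_one
    _ = entropyBits μ := (entropyBits_eq_sum hμs).symm

lemma entropyBits_le {μ : Measure S} [IsFiniteMeasure μ] {s t : Set S} {b : ℝ}
    (hs : s.Finite) (hμs : ∀ᵐ x ∂μ, x ∈ s) (hb : ∀ x ∈ t, -Real.logb 2 (μ.real {x}) ≤ b) :
    entropyBits μ ≤ μ.real t * b + μ.real tᶜ * Real.logb 2 s.ncard + (Real.log 2)⁻¹ := by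
  classical
  lift s to Finset S using hs
  have hsum_t : ∑ x ∈ s with x ∈ t, -(μ.real {x} * Real.logb 2 (μ.real {x})) ≤ μ.real t * b := by
    rw [← sum_filter_measureReal_singleton hμs t, Finset.sum_mul]
    refine Finset.sum_le_sum fun x hx => ?_
    rw [← mul_neg]
    exact mul_le_mul_of_nonneg_left (hb x (Finset.mem_filter.1 hx).2) measureReal_nonneg
  have hsum_compl : ∑ x ∈ s with x ∈ tᶜ, -(μ.real {x} * Real.logb 2 (μ.real {x})) ≤
      μ.real tᶜ * Real.logb 2 (s : Set S).ncard + (Real.log 2)⁻¹ := by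
    rw [← sum_filter_measureReal_singleton hμs tᶜ, Set.ncard_coe_finset]
    exact sum_neg_mul_logb_le (f := fun x => μ.real {x}) (fun _ _ => measureReal_nonneg)
      (Nat.cast_le.2 (s.card_filter_le _))
  rw [entropyBits_eq_sum hμs, ← Finset.sum_filter_add_sum_filter_not s (· ∈ t), add_assoc]
  exact add_le_add hsum_t hsum_compl

lemma uniformOn_real_singleton {A : Set S} (hA : A.Finite) {x : S} (hx : x ∈ A) :
    (uniformOn A).real {x} = (A.ncard : ℝ)⁻¹ := by
  rw [measureReal_def, uniformOn, cond_apply hA.measurableSet,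
    Set.inter_eq_self_of_subset_right (Set.singleton_subset_iff.2 hx), Measure.count_singleton,
    Measure.count_apply_finite A hA, Set.ncard_eq_toFinset_card A hA, mul_one, ENNReal.toReal_inv,
    ENNReal.toReal_natCast]

lemma entropyBits_uniformOn {A : Set S} (hA : A.Finite) :
    entropyBits (uniformOn A) = Real.logb 2 A.ncard := by
  rcases A.eq_empty_or_nonempty with rfl | hne
  · simp [entropyBits, measureReal_def]
  have hcard : (A.ncard : ℝ) ≠ 0 := Nat.cast_ne_zero.2 (hne.ncard_pos hA).ne'
  have hsupp : ∀ᵐ x ∂uniformOn A, x ∈ hA.toFinset :=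
    (ae_cond_mem hA.measurableSet).mono fun _ hx => hA.mem_toFinset.2 hx
  calc entropyBits (uniformOn A)
      = ∑ _x ∈ hA.toFinset, -((A.ncard : ℝ)⁻¹ * Real.logb 2 (A.ncard : ℝ)⁻¹) := by
        rw [entropyBits_eq_sum hsupp]
        refine Finset.sum_congr rfl fun x hx => ?_
        rw [uniformOn_real_singleton hA (hA.mem_toFinset.1 hx)]
    _ = Real.logb 2 A.ncard := by
        rw [Finset.sum_const, ← Set.ncard_eq_toFinset_card A hA, Real.logb_inv, mul_neg, neg_neg,
          nsmul_eq_mul, mul_inv_cancel_left₀ hcard]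

lemma rvEntropy_eq_logb_ncard {Ω : Type*} [MeasurableSpace Ω] {P : Measure Ω} {X : Ω → S}
    {A : Set S} (hA : A.Finite) (hX : HasLaw X (uniformOn A) P) :
    rvEntropy P X = Real.logb 2 A.ncard := by
  rw [rvEntropy, hX.map_eq, entropyBits_uniformOn hA]

end Entropy

section EntropyRate

lemma DotEqOn.exists_neg_logb_mem_Icc {ι : ℕ → Type*} {s : ∀ n, Set (ι n)} {a : ∀ n, ι n → ℝ}
    {b : ℝ} (h : DotEqOn s a (-b)) :
    ∃ ε : ℕ → ℝ, Tendsto ε atTop (𝓝 0) ∧ ∀ᶠ n : ℕ in atTop, ∀ w ∈ s n,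
      -Real.logb 2 (a n w) ∈ Set.Icc (n * (b - ε n)) (n * (b + ε n)) := by
  obtain ⟨ε, -, hε, hs⟩ := h
  refine ⟨ε, hε, hs.mono fun n hn w hw => ?_⟩
  obtain ⟨hlow, hup⟩ := hn w hw
  have hpos : 0 < a n w := (Real.rpow_pos_of_pos two_pos _).trans_le hlow
  rw [← Real.le_logb_iff_rpow_le one_lt_two hpos] at hlow
  rw [← Real.logb_le_iff_le_rpow one_lt_two hpos] at hup
  constructor <;> linarith

lemma tendsto_entropyBits_div {S : ℕ → Type*} [∀ n, MeasurableSpace (S n)]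
    [∀ n, DiscreteMeasurableSpace (S n)] {μ : ∀ n, Measure (S n)}
    [∀ n, IsProbabilityMeasure (μ n)] {s K : ∀ n, Set (S n)} {c I : ℝ}
    (hs : ∀ n, (s n).Finite) (hμs : ∀ n, ∀ᵐ x ∂μ n, x ∈ s n)
    (hcard : ∀ᶠ n : ℕ in atTop, Real.logb 2 (s n).ncard ≤ n * c)
    (hK : Tendsto (fun n => (μ n).real (K n)) atTop (𝓝 1))
    (hprob : DotEqOn K (fun n x => (μ n).real {x}) (-I)) :
    Tendsto (fun n : ℕ => entropyBits (μ n) / n) atTop (𝓝 I) := by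
  obtain ⟨ε, hε, hinfo⟩ := hprob.exists_neg_logb_mem_Icc
  have hKc : Tendsto (fun n => (μ n).real (K n)ᶜ) atTop (𝓝 0) := by
    simpa only [probReal_compl_eq_one_sub (MeasurableSet.of_discrete), sub_self]
      using hK.const_sub 1
  have hlow : Tendsto (fun n => (μ n).real (K n) * (I - ε n)) atTop (𝓝 I) := by
    simpa using hK.mul (hε.const_sub I)
  have hup : Tendsto (fun n : ℕ => (μ n).real (K n) * (I + ε n) + (μ n).real (K n)ᶜ * c
      + (Real.log 2)⁻¹ / n) atTop (𝓝 I) := by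
    simpa using ((hK.mul (hε.const_add I)).add (hKc.mul_const c)).add
      (tendsto_const_div_atTop_nhds_zero_nat (Real.log 2)⁻¹)
  refine tendsto_of_tendsto_of_tendsto_of_le_of_le' hlow hup ?_ ?_
  · filter_upwards [hinfo, eventually_gt_atTop 0] with n hn hn₀
    rw [le_div_iff₀ (Nat.cast_pos.2 hn₀), mul_assoc, mul_comm (I - ε n)]
    exact mul_le_entropyBits (hs n) (hμs n) fun x hx => (hn x hx).1
  · filter_upwards [hinfo, hcard, eventually_gt_atTop 0] with n hn hcardn hn₀
    have hn₀ : (0 : ℝ) < n := Nat.cast_pos.2 hn₀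
    rw [div_le_iff₀ hn₀]
    calc entropyBits (μ n)
        ≤ (μ n).real (K n) * (n * (I + ε n)) + (μ n).real (K n)ᶜ * Real.logb 2 (s n).ncard
            + (Real.log 2)⁻¹ := entropyBits_le (hs n) (hμs n) fun x hx => (hn x hx).2
      _ ≤ (μ n).real (K n) * (n * (I + ε n)) + (μ n).real (K n)ᶜ * (n * c)
            + (Real.log 2)⁻¹ := by gcongr
      _ = ((μ n).real (K n) * (I + ε n) + (μ n).real (K n)ᶜ * c + (Real.log 2)⁻¹ / n) * n := by
        field_simp

end EntropyRate

section Sumset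

lemma ncard_add_le {M : Type*} [Add M] {A B : Set M} (hA : A.Finite) (hB : B.Finite) :
    (A + B).ncard ≤ A.ncard * B.ncard := by
  rw [← Set.add_image_prod, ← Set.ncard_prod]
  exact Set.ncard_image_le (hA.prod hB)

lemma logb_ncard_add_le {M : Type*} [Add M] {A B : Set M} (hA : A.Finite) (hB : B.Finite) :
    Real.logb 2 (A + B).ncard ≤ Real.logb 2 A.ncard + Real.logb 2 B.ncard := by
  have hlogb_nonneg (C : Set M) : 0 ≤ Real.logb 2 C.ncard :=
    div_nonneg (Real.log_natCast_nonneg _) (Real.log_nonneg one_le_two)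
  rcases (A + B).eq_empty_or_nonempty with hAB | hAB
  · simpa [hAB] using add_nonneg (hlogb_nonneg A) (hlogb_nonneg B)
  obtain ⟨hA₀, hB₀⟩ := Set.add_nonempty.1 hAB
  have hA_pos := hA₀.ncard_pos hA
  have hB_pos := hB₀.ncard_pos hB
  have hAB_pos := hAB.ncard_pos (hA.add hB)
  rw [← Real.logb_mul (by positivity) (by positivity)]
  exact Real.logb_le_logb_of_le one_lt_two (by positivity) (mod_cast ncard_add_le hA hB)

lemma eventually_logb_ncard_add_le {M : ℕ → Type*} [∀ n, Add (M n)] {A B : ∀ n, Set (M n)}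
    {R₁ R₂ c : ℝ} (hA : ∀ n, (A n).Finite) (hB : ∀ n, (B n).Finite)
    (hR₁ : Tendsto (fun n : ℕ => Real.logb 2 (A n).ncard / n) atTop (𝓝 R₁))
    (hR₂ : Tendsto (fun n : ℕ => Real.logb 2 (B n).ncard / n) atTop (𝓝 R₂))
    (hc : R₁ + R₂ < c) :
    ∀ᶠ n : ℕ in atTop, Real.logb 2 (A n + B n).ncard ≤ n * c := by
  filter_upwards [(hR₁.add hR₂).eventually_le_const hc, eventually_gt_atTop 0] with n hn hn₀
  rw [← add_div, div_le_iff₀' (Nat.cast_pos.2 hn₀)] at hn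
  exact (logb_ncard_add_le (hA n) (hB n)).trans hn

variable {M : Type*} [AddMonoid M] [Countable M] [MeasurableSpace M] [MeasurableSingletonClass M]

lemma ae_mem_add_sumLaw (A B : Set M) : ∀ᵐ x ∂sumLaw A B, x ∈ A + B := by
  rw [sumLaw, ae_map_iff Measurable.of_discrete.aemeasurable (.of_discrete)]
  filter_upwards [Measure.quasiMeasurePreserving_fst.ae (ae_cond_mem .of_discrete),
    Measure.quasiMeasurePreserving_snd.ae (ae_cond_mem .of_discrete)] with x hx₁ hx₂
  exact Set.add_mem_add hx₁ hx₂

end Sumset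

section Codebook

variable {q n : ℕ} [NeZero q]

lemma intVec_injective : Function.Injective (intVec : (Fin n → ZMod q) → Fin n → ℤ) :=
  fun _ _ h => funext fun i => ZMod.val_injective q (Nat.cast_injective (congrFun h i))

lemma ncard_codebook (C : Submodule (ZMod q) (Fin n → ZMod q)) (d : Fin n → ZMod q) :
    (codebook C d).ncard = Nat.card C :=
  Set.ncard_image_of_injective _ (intVec_injective.comp (add_left_injective d))

end Codebook

theorem theorem3_general {M : ℕ → Type*} [∀ n, AddMonoid (M n)] [∀ n, Countable (M n)]
    [∀ n, MeasurableSpace (M n)] [∀ n, MeasurableSingletonClass (M n)]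
    {A B K : ∀ n, Set (M n)} {R₁ R₂ D : ℝ}
    (hR₁ : Tendsto (fun n : ℕ => Real.logb 2 (A n).ncard / n) atTop (𝓝 R₁))
    (hR₂ : Tendsto (fun n : ℕ => Real.logb 2 (B n).ncard / n) atTop (𝓝 R₂))
    (hK : Tendsto (fun n => (sumLaw (A n) (B n)).real (K n)) atTop (𝓝 1))
    (hprob : DotEqOn K (fun n w => (sumLaw (A n) (B n)).real {w})
      (-min (R₁ + R₂) (max R₁ R₂ + D)))
    {Ω : ℕ → Type*} [∀ n, MeasurableSpace (Ω n)]
    {P : ∀ n, Measure (Ω n)} [∀ n, IsProbabilityMeasure (P n)]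
    {T₁ T₂ : ∀ n, Ω n → M n}
    (hT₁ : ∀ n, HasLaw (T₁ n) (uniformOn (A n)) (P n))
    (hT₂ : ∀ n, HasLaw (T₂ n) (uniformOn (B n)) (P n))
    (hindep : ∀ n, IndepFun (T₁ n) (T₂ n) (P n)) :
    Tendsto (fun n : ℕ => rvEntropy (P n) (fun ω => T₁ n ω + T₂ n ω) / n) atTop
        (𝓝 (min (R₁ + R₂) (max R₁ R₂ + D))) ∧
      Tendsto (fun n : ℕ =>
          min ((rvEntropy (P n) (T₁ n) + rvEntropy (P n) (T₂ n)) / n)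
            (max (rvEntropy (P n) (T₁ n)) (rvEntropy (P n) (T₂ n)) / n + D)) atTop
        (𝓝 (min (R₁ + R₂) (max R₁ R₂ + D))) := by
  have hA (n) : (A n).Finite := finite_of_hasLaw_uniformOn (hT₁ n)
  have hB (n) : (B n).Finite := finite_of_hasLaw_uniformOn (hT₂ n)
  constructor
  · have hsum (n) : HasLaw (fun ω => T₁ n ω + T₂ n ω) (sumLaw (A n) (B n)) (P n) :=
      (hindep n).hasLaw_add (hT₁ n) (hT₂ n)
    have hprobMeasure (n) : IsProbabilityMeasure (sumLaw (A n) (B n)) :=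
      (hsum n).isProbabilityMeasure_iff.1 inferInstance
    simp only [rvEntropy, (hsum _).map_eq]
    exact tendsto_entropyBits_div (fun n => (hA n).add (hB n))
      (fun n => ae_mem_add_sumLaw (A n) (B n))
      (eventually_logb_ncard_add_le hA hB hR₁ hR₂ (lt_add_one _)) hK hprob
  · refine ((hR₁.add hR₂).min ((hR₁.max hR₂).add_const D)).congr fun n => ?_
    rw [rvEntropy_eq_logb_ncard (hA n) (hT₁ n), rvEntropy_eq_logb_ncard (hB n) (hT₂ n), add_div,
      max_div_div_right n.cast_nonneg]

theorem theorem3 (q : ℕ) [Fact q.Prime]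
    (C₁ C₂ : ∀ n : ℕ, Submodule (ZMod q) (Fin n → ZMod q))
    (d : ∀ n : ℕ, Fin n → ZMod q)
    (R₁ R₂ : ℝ)
    (hR₁ : Tendsto (fun n : ℕ => Real.logb 2 (Nat.card (C₁ n)) / n) atTop (𝓝 R₁))
    (hR₂ : Tendsto (fun n : ℕ => Real.logb 2 (Nat.card (C₂ n)) / n) atTop (𝓝 R₂))
    (K : ∀ n : ℕ, Set (Fin n → ℤ))
    (hK : IsNormalTypicalSumset q R₁ R₂
      (fun n => codebook (C₁ n) (d n)) (fun n => codebook (C₂ n) 0) K)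
    {Ω : ℕ → Type*} [∀ n, MeasurableSpace (Ω n)]
    (P : ∀ n, Measure (Ω n)) [∀ n, IsProbabilityMeasure (P n)]
    (T₁ T₂ : ∀ n, Ω n → (Fin n → ℤ))
    (hT₁ : ∀ n, HasLaw (T₁ n) (uniformOn (codebook (C₁ n) (d n))) (P n))
    (hT₂ : ∀ n, HasLaw (T₂ n) (uniformOn (codebook (C₂ n) 0)) (P n))
    (hindep : ∀ n, IndepFun (T₁ n) (T₂ n) (P n)) :
    Tendsto (fun n : ℕ => rvEntropy (P n) (fun ω => T₁ n ω + T₂ n ω) / n) atTop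
        (𝓝 (min (R₁ + R₂) (max R₁ R₂ + sumsetD q))) ∧
      Tendsto (fun n : ℕ =>
          min ((rvEntropy (P n) (T₁ n) + rvEntropy (P n) (T₂ n)) / n)
            (max (rvEntropy (P n) (T₁ n)) (rvEntropy (P n) (T₂ n)) / n + sumsetD q)) atTop
        (𝓝 (min (R₁ + R₂) (max R₁ R₂ + sumsetD q))) :=
  theorem3_general (by simpa only [ncard_codebook] using hR₁)
    (by simpa only [ncard_codebook] using hR₂) hK.tendsto_prob hK.prob_doteq hT₁ hT₂ hindep
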